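/- Throughout, $B(x,r)=\{y\in X: d(x,y)\le r\}$ denotes a closed ball with $r\ge 0$, $d(x,A)=\inf_{a\in A}d(x,a)$ (with $\inf\emptyset=\infty$), and, for $A\neq\emptyset$, $B(A,s)=\{x\in X: d(x,A)\le s\}$. A metric space $X$ is hyperconvex if for every non-empty family of closed balls $\{B(x_i,r_i)\}_{i\in I}$ in $X$ with $d(x_i,x_j)\le r_i+r_j$ for all $i,j$ one has $\bigcap_i B(x_i,r_i)\ne\emptyset$. For $A\subset Y\subset X$, the set $A$ is externally hyperconvex in $Y$ if for every non-empty family $\{B(x_i,r_i)\}_{i\in I}$ with $x_i\in Y$, $d(x_i,A)\le r_i$ and $d(x_i,x_j)\le r_i+r_j$ for all $i,j$ one has $A\cap\bigcap_i B(x_i,r_i)\neq\emptyset$. The set $A$ is uniformly locally externally hyperconvex in $X$ if there is some $r>0$ such that $A\cap B(x,r)$ is externally hyperconvex in $B(x,r)$ for every $x\in A$. A proximinal $1$-Lipschitz retraction $\rho\colon X\to A$ is a $1$-Lipschitz map with $\rho(a)=a$ for all $a\in A$ and $d(x,\rho(x))=d(x,A)$ for all $x\in X$. A geodesic bicombing on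 $X$ is a map $\sigma\colon X\times X\times[0,1]\to X$, $(x,y,t)\mapsto\sigma_{xy}(t)$, such that for all $x,y,x',y'\in X$ and $s,t\in[0,1]$: $\sigma_{xy}(0)=x$, $\sigma_{xy}(1)=y$, $d(\sigma_{xy}(s),\sigma_{xy}(t))=|s-t|\,d(x,y)$, $\sigma_{yx}(t)=\sigma_{xy}(1-t)$, and $d(\sigma_{xy}(t),\sigma_{x'y'}(t))\le(1-t)d(x,x')+t\,d(y,y')$. It is convex if for all $x,y,x',y'\in X$ the function $t\mapsto d(\sigma_{xy}(t),\sigma_{x'y'}(t))$ is convex on $[0,1]$. A set $A\subset X$ is $\sigma$-convex if $\sigma_{xy}([0,1])\subset A$ for all $x,y\in A$. **Theorem.** Let $X$ be a hyperconvex metric space and $A\subset X$ a non-empty subset. Then the following are equivalent: 1. $A$ is externally hyperconvex in $X$. 2. For all $x\in X$ and all $r\ge d(x,A)$, $A\cap B(x,r)$ is externally hyperconvex in $B(x,r)$. 3. There is some $x\in X$ such that for all $r\ge d(x,A)$, $A\cap B(x,r)$ is externally hyperconvex in $B(x,r)$. 4. $A$ is externally hyperconvex in $B(A,s)$ for all $s>0$.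 5. $A$ is externally hyperconvex in $B(A,s)$ for some $s>0$. 6. There is a proximinal $1$-Lipschitz retraction $\rho\colon X\to A$ such that $d(\rho(x),y)\le\max\{d(x,y),d(A,y)\}$ for all $x,y\in X$. Moreover, for every convex geodesic bicombing $\sigma$ on $X$, these conditions are also equivalent to: 7. $A$ is $\sigma$-convex and uniformly locally externally hyperconvex in $X$. -/

import Mathlib

open Set Metric

universe u

/-- A metric space is hyperconvex if every family of closed balls `B(x i, r i)` with
`d(x i, x j) ≤ r i + r j` has a common point. Families indexed by types of the universe of `X`
suffice: a family may always be reindexed by the set of its pairs (centre, radius). -/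
def HyperconvexSpace (X : Type u) [MetricSpace X] : Prop :=
  ∀ (ι : Type u) [Nonempty ι] (x : ι → X) (r : ι → ℝ),
    (∀ i, 0 ≤ r i) → (∀ i j, dist (x i) (x j) ≤ r i + r j) →
      (⋂ i, closedBall (x i) (r i)).Nonempty

/-- For subsets `A ⊆ Y` of a metric space: `A` is externally hyperconvex in the subspace `Y`.
The distance to the empty set is `∞`. As `A ⊆ Y`, the balls of `Y` and those of the ambient
space have the same intersection with `A`. "Externally hyperconvex in the whole space" is
the case `Y = Set.univ`. -/
def ExternallyHyperconvexIn {X : Type u} [MetricSpace X] (A Y : Set X) : Prop :=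
  A ⊆ Y ∧
    ∀ (ι : Type u) [Nonempty ι] (x : ι → X) (r : ι → ℝ),
      (∀ i, x i ∈ Y) → (∀ i, 0 ≤ r i) →
      (∀ i, infEDist (x i) A ≤ ENNReal.ofReal (r i)) →
      (∀ i j, dist (x i) (x j) ≤ r i + r j) →
        (A ∩ ⋂ i, closedBall (x i) (r i)).Nonempty

/-- `A` is uniformly locally externally hyperconvex in the ambient space. -/
def UniformlyLocallyExternallyHyperconvex {X : Type u} [MetricSpace X] (A : Set X) : Prop :=
  ∃ r : ℝ, 0 < r ∧ ∀ x ∈ A, ExternallyHyperconvexIn (A ∩ closedBall x r) (closedBall x r)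

/-- `ρ` is a proximinal `1`-Lipschitz retraction of the ambient space onto the non-empty set `A`:
it maps every point to a nearest point of `A`. -/
structure IsProximinalLipschitzRetraction {X : Type u} [MetricSpace X]
    (A : Set X) (ρ : X → X) : Prop where
  mapsTo : ∀ x, ρ x ∈ A
  retract : ∀ a ∈ A, ρ a = a
  lipschitz : LipschitzWith 1 ρ
  proximinal : ∀ x, dist x (ρ x) = infDist x A

/-- A geodesic bicombing. The parameter of `σ x y` lives in `[0,1]`: values outside of this
interval are never referred to. -/
structure IsGeodesicBicombing {X : Type u} [MetricSpace X] (σ : X → X → ℝ → X) : Prop where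
  zero : ∀ x y, σ x y 0 = x
  one : ∀ x y, σ x y 1 = y
  geodesic : ∀ x y, ∀ s ∈ Icc (0 : ℝ) 1, ∀ t ∈ Icc (0 : ℝ) 1,
    dist (σ x y s) (σ x y t) = |s - t| * dist x y
  symmetric : ∀ x y, ∀ t ∈ Icc (0 : ℝ) 1, σ y x t = σ x y (1 - t)
  weaklyConvex : ∀ x y x' y', ∀ t ∈ Icc (0 : ℝ) 1,
    dist (σ x y t) (σ x' y' t) ≤ (1 - t) * dist x x' + t * dist y y'

/-- A convex geodesic bicombing. -/
structure IsConvexGeodesicBicombing {X : Type u} [MetricSpace X]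
    (σ : X → X → ℝ → X) : Prop extends IsGeodesicBicombing σ where
  convex : ∀ x y x' y',
    ConvexOn ℝ (Icc (0 : ℝ) 1) (fun t => dist (σ x y t) (σ x' y' t))

/-- `A` is `σ`-convex. -/
def BicombingConvex {X : Type u} (σ : X → X → ℝ → X) (A : Set X) : Prop :=
  ∀ x ∈ A, ∀ y ∈ A, ∀ t ∈ Icc (0 : ℝ) 1, σ x y t ∈ A

/-! ### Common points of families of balls -/

variable {X : Type u} [MetricSpace X] {A Y : Set X}

/-! Everything passes through shadows: `a ∈ A` is a shadow of `z` when `d(a,y) ≤ max(d(z,y),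
d(y,A))` for every `y`. If all points have shadows, a compatible family of balls whose radii reach
`A` has a common point `z` by hyperconvexity, and a shadow of `z` lies in each ball and in `A`.
Conversely, the balls with these radii about all `y` are pairwise compatible, since `z` lies in each
of them, so external hyperconvexity supplies shadows. A retraction as in (6) is a 1-Lipschitz choice
of shadows, made by Zorn's lemma.

The local conditions yield shadows only for points near `A` or for bounded families. Hyperconvexity
of `X` removes the restriction: balls with far centres are replaced by smaller balls inside them,
with centres closer to `A`. -/

lemma infEDist_le_ofReal_iff (hA : A.Nonempty) {x : X} {r : ℝ} (hr : 0 ≤ r) :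
    infEDist x A ≤ ENNReal.ofReal r ↔ infDist x A ≤ r :=
  ENNReal.le_ofReal_iff_toReal_le (infEDist_ne_top hA) hr

lemma HyperconvexSpace.exists_of_set (hX : HyperconvexSpace X) {S : Set (X × ℝ)}
    (hS : S.Nonempty) (h0 : ∀ p ∈ S, 0 ≤ p.2)
    (hd : ∀ p ∈ S, ∀ q ∈ S, dist p.1 q.1 ≤ p.2 + q.2) :
    ∃ a, ∀ p ∈ S, dist a p.1 ≤ p.2 := by
  have := hS.to_subtype
  obtain ⟨a, ha⟩ := hX S (fun p => p.1.1) (fun p => p.1.2) (fun p => h0 _ p.2)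
    (fun p q => hd _ p.2 _ q.2)
  exact ⟨a, fun p hp => by simpa using mem_iInter.1 ha ⟨p, hp⟩⟩

lemma HyperconvexSpace.exists_dist_le_three (hX : HyperconvexSpace X) {x y z : X} {r s t : ℝ}
    (hr : 0 ≤ r) (hs : 0 ≤ s) (ht : 0 ≤ t) (hxy : dist x y ≤ r + s) (hxz : dist x z ≤ r + t)
    (hyz : dist y z ≤ s + t) : ∃ p, dist p x ≤ r ∧ dist p y ≤ s ∧ dist p z ≤ t := by
  obtain ⟨p, hp⟩ := hX.exists_of_set (S := {(x, r), (y, s), (z, t)}) ⟨(x, r), by simp⟩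
    (by rintro p (rfl | rfl | rfl) <;> assumption)
    (by
      rintro p (rfl | rfl | rfl) q (rfl | rfl | rfl) <;>
        simp only [dist_self] <;> first | linarith | (rw [dist_comm]; linarith))
  exact ⟨p, hp (x, r) (by simp), hp (y, s) (by simp), hp (z, t) (by simp)⟩

lemma HyperconvexSpace.exists_dist_le_two (hX : HyperconvexSpace X) {x y : X} {r s : ℝ}
    (hr : 0 ≤ r) (hs : 0 ≤ s) (hxy : dist x y ≤ r + s) : ∃ p, dist p x ≤ r ∧ dist p y ≤ s := by
  obtain ⟨p, h1, h2, -⟩ := hX.exists_dist_le_three hr hs hs hxy hxy (by simp; linarith)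
  exact ⟨p, h1, h2⟩

lemma ExternallyHyperconvexIn.exists_of_set (h : ExternallyHyperconvexIn A Y) (hA : A.Nonempty)
    {S : Set (X × ℝ)} (hS : S.Nonempty) (hY : ∀ p ∈ S, p.1 ∈ Y)
    (hi : ∀ p ∈ S, infDist p.1 A ≤ p.2)
    (hd : ∀ p ∈ S, ∀ q ∈ S, dist p.1 q.1 ≤ p.2 + q.2) :
    ∃ a ∈ A, ∀ p ∈ S, dist a p.1 ≤ p.2 := by
  have := hS.to_subtype
  have h0 : ∀ p ∈ S, 0 ≤ p.2 := fun p hp => infDist_nonneg.trans (hi p hp)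
  obtain ⟨a, haA, ha⟩ := h.2 S (fun p => p.1.1) (fun p => p.1.2) (fun p => hY _ p.2)
    (fun p => h0 _ p.2) (fun p => (infEDist_le_ofReal_iff hA (h0 _ p.2)).2 (hi _ p.2))
    (fun p q => hd _ p.2 _ q.2)
  exact ⟨a, haA, fun p hp => by simpa using mem_iInter.1 ha ⟨p, hp⟩⟩

/-- The strict slack keeps all sufficiently good approximate nearest points of `A` inside the ball.
-/
lemma infDist_inter_closedBall_le (hA : A.Nonempty) {x y : X} {R : ℝ}
    (h : dist y x + infDist y A < R) :
    (A ∩ closedBall x R).Nonempty ∧ infDist y (A ∩ closedBall x R) ≤ infDist y A := by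
  have key : ∀ c, infDist y A < c → ∃ a ∈ A ∩ closedBall x R, dist y a < c := by
    intro c hc
    obtain ⟨a, haA, ha⟩ := (infDist_lt_iff hA).1 (lt_min hc (lt_sub_iff_add_lt'.2 h))
    refine ⟨a, ⟨haA, ?_⟩, ha.trans_le (min_le_left _ _)⟩
    have h1 := ha.trans_le (min_le_right _ _)
    have h2 := dist_triangle_left a x y
    rw [mem_closedBall]
    linarith
  obtain ⟨a, ha, -⟩ := key _ (lt_add_one _)
  refine ⟨⟨a, ha⟩, le_of_forall_gt_imp_ge_of_dense fun c hc => ?_⟩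
  obtain ⟨b, hb, hbc⟩ := key c hc
  exact (infDist_le_dist_of_mem hb).trans hbc.le

lemma exists_mem_of_inter_closedBall (hA : A.Nonempty) {x : X} {R : ℝ}
    (h : ExternallyHyperconvexIn (A ∩ closedBall x R) (closedBall x R))
    {S : Set (X × ℝ)} (hS : S.Nonempty) (hR : ∀ p ∈ S, dist p.1 x + infDist p.1 A < R)
    (hi : ∀ p ∈ S, infDist p.1 A ≤ p.2)
    (hd : ∀ p ∈ S, ∀ q ∈ S, dist p.1 q.1 ≤ p.2 + q.2) :
    ∃ a ∈ A, ∀ p ∈ S, dist a p.1 ≤ p.2 := by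
  obtain ⟨p, hp⟩ := hS
  obtain ⟨a, ha, h'⟩ := h.exists_of_set (infDist_inter_closedBall_le hA (hR p hp)).1 ⟨p, hp⟩
    (fun q hq => mem_closedBall.2 (by linarith [hR q hq, infDist_nonneg (x := q.1) (s := A)]))
    (fun q hq => (infDist_inter_closedBall_le hA (hR q hq)).2.trans (hi q hq)) hd
  exact ⟨a, ha.1, h'⟩

/-! ### Shadows and retractions -/

/-- Every point `z` of `Z` has a shadow in `A`: a point of `A` that is no farther from any `y ∈ Y`
than `z` is, as far as the distance from `y` to `A` allows. -/
def HasShadows (A Z Y : Set X) : Prop :=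
  ∀ z ∈ Z, ∃ a ∈ A, ∀ y ∈ Y, dist a y ≤ max (dist z y) (infDist y A)

lemma dist_le_max_add_max (z y y' : X) (c c' : ℝ) :
    dist y y' ≤ max (dist z y) c + max (dist z y') c' :=
  (dist_triangle_left y y' z).trans (add_le_add (le_max_left _ _) (le_max_left _ _))

lemma ExternallyHyperconvexIn.hasShadows (h : ExternallyHyperconvexIn A Y) (hA : A.Nonempty) :
    HasShadows A univ Y := by
  intro z _
  obtain ⟨a, ha, h'⟩ := h.exists_of_set hA
    (S := (fun y => (y, max (dist z y) (infDist y A))) '' Y) ((hA.mono h.1).image _)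
    (by rintro _ ⟨y, hy, rfl⟩; exact hy)
    (by rintro _ ⟨y, hy, rfl⟩; exact le_max_right _ _)
    (by rintro _ ⟨y, hy, rfl⟩ _ ⟨y', hy', rfl⟩; exact dist_le_max_add_max _ _ _ _ _)
  exact ⟨a, ha, fun y hy => h' _ ⟨y, hy, rfl⟩⟩

lemma HasShadows.externallyHyperconvexIn (hX : HyperconvexSpace X) (hA : A.Nonempty)
    (h : HasShadows A univ univ) : ExternallyHyperconvexIn A univ := by
  refine ⟨subset_univ _, fun ι _ x r _ h0 hi hd => ?_⟩
  obtain ⟨z, hz⟩ := hX ι x r h0 hd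
  obtain ⟨a, ha, h'⟩ := h z (mem_univ z)
  exact ⟨a, ha, mem_iInter.2 fun i => (h' (x i) (mem_univ _)).trans
    (max_le (mem_iInter.1 hz i) ((infEDist_le_ofReal_iff hA (h0 i)).1 (hi i)))⟩

lemma ExternallyHyperconvexIn.mono (h : ExternallyHyperconvexIn A univ) (hY : A ⊆ Y) :
    ExternallyHyperconvexIn A Y :=
  ⟨hY, fun ι _ x r _ => h.2 ι x r fun _ => mem_univ _⟩

lemma ExternallyHyperconvexIn.inter_closedBall (h : ExternallyHyperconvexIn A univ)
    (hA : A.Nonempty) {x : X} {r : ℝ} (hr : infDist x A ≤ r) :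
    ExternallyHyperconvexIn (A ∩ closedBall x r) (closedBall x r) := by
  refine ⟨inter_subset_right, fun ι _ y s hy h0 hi hd => ?_⟩
  have hr0 : 0 ≤ r := infDist_nonneg.trans hr
  -- The ball `B(x,r)` itself joins the family, as the member `none`.
  obtain ⟨a, ha, h'⟩ := h.2 (Option ι) (fun i => i.elim x y) (fun i => i.elim r s)
    (fun _ => mem_univ _) (by rintro (_ | i); exacts [hr0, h0 i])
    (by
      rintro (_ | i)
      · exact (infEDist_le_ofReal_iff hA hr0).2 hr
      · exact (infEDist_anti inter_subset_left).trans (hi i))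
    (by
      rintro (_ | i) (_ | j)
      · simpa using hr0
      · have := mem_closedBall'.1 (hy j)
        exact this.trans (le_add_of_nonneg_right (h0 j))
      · have := mem_closedBall.1 (hy i)
        exact this.trans (le_add_of_nonneg_left (h0 i))
      · exact hd i j)
  rw [mem_iInter] at h'
  exact ⟨a, ⟨ha, h' none⟩, mem_iInter.2 fun i => h' (some i)⟩

/-- Take a maximal graph `G` of a 1-Lipschitz partial choice of shadows. It is total: the balls
prescribing the Lipschitz bound at a new `z` have centres in `A`, and are compatible with the shadow
balls because the old values are shadows. -/
lemma ExternallyHyperconvexIn.exists_retraction (h : ExternallyHyperconvexIn A univ)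
    (hA : A.Nonempty) :
    ∃ ρ : X → X, IsProximinalLipschitzRetraction A ρ ∧
      ∀ x y : X, dist (ρ x) y ≤ max (dist x y) (infDist y A) := by
  let P : Set (X × X) :=
    {p | p.2 ∈ A ∧ ∀ y, dist p.2 y ≤ max (dist p.1 y) (infDist y A)}
  obtain ⟨G, hG⟩ := zorn_subset
    {G : Set (X × X) | G ⊆ P ∧ ∀ p ∈ G, ∀ q ∈ G, dist p.2 q.2 ≤ dist p.1 q.1} (by
      intro c hc hchain
      refine ⟨⋃₀ c, ⟨sUnion_subset fun G hG => (hc hG).1, ?_⟩, fun G hG => subset_sUnion_of_mem hG⟩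
      rintro p ⟨G, hG, hp⟩ q ⟨G', hG', hq⟩
      rcases hchain.total hG hG' with hle | hle
      · exact (hc hG').2 p (hle hp) q hq
      · exact (hc hG).2 p hp q (hle hq))
  obtain ⟨⟨hGP, hGd⟩, hmax⟩ := hG
  have total : ∀ z, ∃ a, (z, a) ∈ G := by
    intro z
    obtain ⟨a, ha, h'⟩ := h.exists_of_set hA
      (S := (fun p : X × X => (p.2, dist z p.1)) '' G ∪
        range fun y => (y, max (dist z y) (infDist y A)))
      ⟨_, Or.inr ⟨z, rfl⟩⟩ (fun _ _ => mem_univ _)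
      (by
        rintro _ (⟨p, hp, rfl⟩ | ⟨y, rfl⟩)
        · simp [infDist_zero_of_mem (hGP hp).1]
        · exact le_max_right _ _)
      (by
        have mixed : ∀ p ∈ G, ∀ y, dist p.2 y ≤ dist z p.1 + max (dist z y) (infDist y A) := by
          intro p hp y
          refine ((hGP hp).2 y).trans (max_le ?_ ?_)
          · exact (dist_triangle_left _ _ z).trans (by gcongr; exact le_max_left _ _)
          · exact (le_max_right _ _).trans (le_add_of_nonneg_left dist_nonneg)
        rintro _ (⟨p, hp, rfl⟩ | ⟨y, rfl⟩) _ (⟨q, hq, rfl⟩ | ⟨y', rfl⟩)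
        · exact (hGd p hp q hq).trans (dist_triangle_left _ _ _)
        · exact mixed p hp y'
        · simpa only [dist_comm y, add_comm] using mixed q hq y
        · exact dist_le_max_add_max _ _ _ _ _)
    have haG : ∀ p ∈ G, dist a p.2 ≤ dist z p.1 := fun p hp => h' _ (Or.inl ⟨p, hp, rfl⟩)
    refine ⟨a, hmax (y := insert (z, a) G) ⟨?_, ?_⟩ (subset_insert _ _) (mem_insert _ _)⟩
    · exact insert_subset ⟨ha, fun y => h' _ (Or.inr ⟨y, rfl⟩)⟩ hGP
    · rintro p (rfl | hp) q (rfl | hq)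
      · simp
      · exact haG q hq
      · simpa only [dist_comm] using haG p hp
      · exact hGd p hp q hq
  choose ρ hρ using total
  have hmem : ∀ x, ρ x ∈ A := fun x => (hGP (hρ x)).1
  have hle : ∀ x y, dist (ρ x) y ≤ max (dist x y) (infDist y A) := fun x => (hGP (hρ x)).2
  have hprox : ∀ x, dist x (ρ x) ≤ infDist x A := fun x => by
    simpa [dist_comm, infDist_nonneg] using hle x x
  refine ⟨ρ, ⟨hmem, fun a ha => ?_, ?_, fun x => ?_⟩, hle⟩
  · have := hprox a
    rw [infDist_zero_of_mem ha] at this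
    exact (dist_le_zero.1 this).symm
  · exact LipschitzWith.of_dist_le_mul fun x y => by simpa using hGd _ (hρ x) _ (hρ y)
  · exact (hprox x).antisymm (infDist_le_dist_of_mem (hmem x))

/-! ### Balls about one centre -/

lemma externallyHyperconvexIn_univ_of_inter_closedBall (hX : HyperconvexSpace X)
    (hA : A.Nonempty) {x : X} (h : ∀ r : ℝ, infDist x A ≤ r →
      ExternallyHyperconvexIn (A ∩ closedBall x r) (closedBall x r)) :
    ExternallyHyperconvexIn A univ := by
  have bounded : ∀ S : Set (X × ℝ), S.Nonempty → (∃ C, ∀ p ∈ S, dist p.1 x ≤ C) →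
      (∀ p ∈ S, infDist p.1 A ≤ p.2) →
      (∀ p ∈ S, ∀ q ∈ S, dist p.1 q.1 ≤ p.2 + q.2) → ∃ a ∈ A, ∀ p ∈ S, dist a p.1 ≤ p.2 := by
    rintro S hS ⟨C, hC⟩ hi hd
    obtain ⟨p, hp⟩ := hS
    have hC0 : 0 ≤ C := dist_nonneg.trans (hC p hp)
    -- A centre `y` within `C` of `x` has `d(y,A) ≤ C + d(x,A)`.
    refine exists_mem_of_inter_closedBall hA (h (2 * C + infDist x A + 1) (by linarith)) ⟨p, hp⟩
      (fun q hq => ?_) hi hd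
    have := infDist_le_infDist_add_dist (s := A) (x := q.1) (y := x)
    linarith [hC q hq]
  refine HasShadows.externallyHyperconvexIn hX hA fun z _ => ?_
  set T := infDist z A
  have hT : 0 ≤ T := infDist_nonneg
  let R : X → ℝ := fun y => max (dist z y) (infDist y A)
  -- Each shadow ball `B(y, R y)` contains a ball of radius at most `T` that contains `z` and has
  -- its centre within `T` of `z`. These smaller balls form a bounded family.
  have near : ∀ y, ∃ y', dist z y' ≤ min T (R y) ∧ infDist y' A ≤ min T (R y) ∧
      dist y y' ≤ R y - min T (R y) ∨ (y' = y ∧ R y ≤ T) := by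
    intro y
    by_cases hRT : R y ≤ T
    · exact ⟨y, Or.inr ⟨rfl, hRT⟩⟩
    · push Not at hRT
      rw [min_eq_left hRT.le]
      have hzy : dist z y ≤ R y := le_max_left _ _
      obtain ⟨a, ha, h'⟩ := bounded {(z, T), (y, R y)} ⟨(z, T), by simp⟩
        ⟨max (dist z x) (dist y x), by rintro p (rfl | rfl) <;> simp⟩
        (by rintro p (rfl | rfl); exacts [le_rfl, le_max_right _ _])
        (by
          rintro p (rfl | rfl) q (rfl | rfl) <;> simp only [dist_self] <;>
            first | linarith | (rw [dist_comm]; linarith))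
      have haz : dist a z ≤ T := h' (z, T) (by simp)
      have hay : dist a y ≤ R y := h' (y, R y) (by simp)
      obtain ⟨y', h1, h2, h3⟩ := hX.exists_dist_le_three (x := y) (y := z) (z := a)
        (sub_nonneg.2 hRT.le) hT hT (by rw [dist_comm]; linarith) (by rw [dist_comm]; linarith)
        (by rw [dist_comm]; linarith)
      refine ⟨y', Or.inl ⟨by rwa [dist_comm], (infDist_le_dist_of_mem ha).trans h3, ?_⟩⟩
      rwa [dist_comm]
  have near' : ∀ y, ∃ y', dist z y' ≤ min T (R y) ∧ infDist y' A ≤ min T (R y) ∧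
      dist y y' ≤ R y - min T (R y) := by
    intro y
    obtain ⟨y', hy' | ⟨rfl, hR⟩⟩ := near y
    · exact ⟨y', hy'⟩
    · refine ⟨y', ?_⟩
      rw [min_eq_right hR]
      exact ⟨le_max_left _ _, le_max_right _ _, by simp⟩
  choose f hf1 hf2 hf3 using near'
  obtain ⟨a, ha, h'⟩ := bounded (range fun y => (f y, min T (R y))) ⟨_, z, rfl⟩
    ⟨T + dist z x, by
      rintro _ ⟨y, rfl⟩
      have := dist_triangle_left (f y) x z
      linarith [(hf1 y).trans (min_le_left _ _)]⟩
    (by rintro _ ⟨y, rfl⟩; exact hf2 y)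
    (by
      rintro _ ⟨y, rfl⟩ _ ⟨y', rfl⟩
      exact (dist_triangle_left _ _ z).trans (add_le_add (hf1 y) (hf1 y')))
  refine ⟨a, ha, fun y _ => ?_⟩
  have h1 : dist a (f y) ≤ min T (R y) := h' _ ⟨y, rfl⟩
  have h2 := dist_triangle_right a y (f y)
  change dist a y ≤ R y
  linarith [hf3 y]

/-! ### Neighbourhoods of `A` -/

lemma dist_le_max_of_infDist_le_add (hX : HyperconvexSpace X) (hA : A.Nonempty) {s t : ℝ}
    (hs : 0 < s) (hst : s ≤ t) {ρ : X → X} (hρ : ∀ z, infDist z A ≤ s → ρ z ∈ A)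
    (h : ∀ z, infDist z A ≤ s → ∀ y, infDist y A ≤ t →
      dist (ρ z) y ≤ max (dist z y) (infDist y A)) :
    ∀ z, infDist z A ≤ s → ∀ y, infDist y A ≤ t + s / 4 →
      dist (ρ z) y ≤ max (dist z y) (infDist y A) := by
  intro z hz y hy
  by_cases hyt : infDist y A ≤ t
  · exact h z hz y hyt
  push Not at hyt
  obtain ⟨δ, hδ⟩ : ∃ δ, infDist y A = t + δ := ⟨infDist y A - t, by ring⟩
  obtain ⟨R, hR⟩ : ∃ R, max (dist z y) (infDist y A) = R := ⟨_, rfl⟩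
  have hzR : dist z y ≤ R := hR ▸ le_max_left _ _
  have hyR : t + δ ≤ R := hδ ▸ hR ▸ le_max_right _ _
  rw [hR]
  refine le_of_forall_pos_le_add fun ε hε => ?_
  obtain ⟨η, hη0, hηε, hηs⟩ : ∃ η, 0 < η ∧ η ≤ ε ∧ η ≤ s / 4 :=
    ⟨min ε (s / 4), by positivity, min_le_left _ _, min_le_right _ _⟩
  obtain ⟨a, ha, hya⟩ := (infDist_lt_iff hA).1 (lt_add_of_pos_right (infDist y A) hη0)
  obtain ⟨u, huy, hua⟩ := hX.exists_dist_le_two (x := y) (y := a) (r := δ + η) (s := t)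
    (by linarith) (by linarith) (by linarith)
  have hut : infDist u A ≤ t := (infDist_le_dist_of_mem ha).trans hua
  -- The point `a` may be too far from `z`. Its substitute is `ρ w`, within `t` of `u` and `R - δ +
  -- t` of `z`; the choice of `w` needs `2δ + η ≤ s`, whence the quarters of `s`.
  obtain ⟨w, hwa, hwu, hwz⟩ := hX.exists_dist_le_three (x := a) (y := u) (z := z) (r := s)
    (s := t) (t := R - δ + t) hs.le (by linarith) (by linarith)
    (by rw [dist_comm]; linarith)
    (by
      have h1 := dist_triangle4 a u y z
      rw [dist_comm a u, dist_comm y z] at h1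
      linarith)
    (by
      have h1 := dist_triangle u y z
      rw [dist_comm y z] at h1
      linarith)
  have hw : infDist w A ≤ s := (infDist_le_dist_of_mem ha).trans hwa
  have h1 : dist (ρ w) u ≤ t := (h w hw u hut).trans (max_le hwu hut)
  have h2 : dist (ρ w) z ≤ R - δ + t :=
    (h w hw z (hz.trans hst)).trans (max_le hwz (by linarith))
  -- Being within `t` of `ρ w ∈ A`, `v` is a test point to which `h` applies, and it lies almost on
  -- a geodesic from `z` to `y`.
  obtain ⟨v, hvy, hvw, hvz⟩ := hX.exists_dist_le_three (x := y) (y := ρ w) (z := z) (r := δ + η)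
    (s := t) (t := R - δ) (by linarith) (by linarith) (by linarith)
    (by
      have h3 := dist_triangle_left y (ρ w) u
      rw [dist_comm u (ρ w)] at h3
      linarith)
    (by rw [dist_comm]; linarith) (by linarith)
  have hv : infDist v A ≤ t := (infDist_le_dist_of_mem (hρ w hw)).trans hvw
  have h4 : dist (ρ z) v ≤ R - δ :=
    (h z hz v hv).trans (max_le (by rwa [dist_comm]) (by linarith))
  linarith [dist_triangle (ρ z) v y]

/-- Test points are freed first, in steps of `s/4`. Then `z₀` is moved towards `A` in steps of `s/2`
without leaving its shadow balls, until it has a shadow. -/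
lemma HasShadows.univ_of_infDist_le (hX : HyperconvexSpace X) (hA : A.Nonempty) {s : ℝ}
    (hs : 0 < s) (h : HasShadows A {z | infDist z A ≤ s} {y | infDist y A ≤ s}) :
    HasShadows A univ univ := by
  obtain ⟨ρ, hρ⟩ : ∃ ρ : X → X, ∀ z, infDist z A ≤ s → ρ z ∈ A ∧
      ∀ y, infDist y A ≤ s → dist (ρ z) y ≤ max (dist z y) (infDist y A) := by
    choose! ρ h1 h2 using h
    exact ⟨ρ, fun z hz => ⟨h1 z hz, h2 z hz⟩⟩
  have hρA : ∀ z, infDist z A ≤ s → ρ z ∈ A := fun z hz => (hρ z hz).1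
  have extend : ∀ n : ℕ, ∀ z, infDist z A ≤ s → ∀ y, infDist y A ≤ s + n * (s / 4) →
      dist (ρ z) y ≤ max (dist z y) (infDist y A) := by
    intro n
    induction n with
    | zero => exact fun z hz y hy => (hρ z hz).2 y (by simpa using hy)
    | succ n ih =>
      have := dist_le_max_of_infDist_le_add hX hA hs
        (le_add_of_nonneg_right (by positivity)) hρA ih
      intro z hz y hy
      refine this z hz y (hy.trans_eq ?_)
      push_cast
      ring
  have shadow : ∀ z, infDist z A ≤ s → ∀ y, dist (ρ z) y ≤ max (dist z y) (infDist y A) := by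
    intro z hz y
    obtain ⟨n, hn⟩ := exists_nat_ge (infDist y A / (s / 4))
    rw [div_le_iff₀ (by positivity)] at hn
    exact extend n z hz y (by linarith)
  intro z₀ _
  let r : X → ℝ := fun y => max (dist z₀ y) (infDist y A)
  have hr0 : ∀ y, 0 ≤ r y := fun y => dist_nonneg.trans (le_max_left _ _)
  have descend : ∀ n : ℕ, (∃ z, infDist z A ≤ s + n * (s / 2) ∧ ∀ y, dist z y ≤ r y) →
      ∃ z, infDist z A ≤ s ∧ ∀ y, dist z y ≤ r y := by
    intro n
    induction n with
    | zero => simp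
    | succ n ih =>
      rintro ⟨z, hz, hzr⟩
      apply ih
      have ht : s ≤ s + n * (s / 2) := le_add_of_nonneg_right (by positivity)
      have hz' : infDist z A < s + n * (s / 2) + s := by
        push_cast at hz
        linarith
      generalize s + n * (s / 2) = t at *
      obtain ⟨a, ha, hza⟩ := (infDist_lt_iff hA).1 hz'
      obtain ⟨u, hua, huz⟩ := hX.exists_dist_le_two (x := a) (y := z) hs.le
        (hs.le.trans ht) (by rw [dist_comm]; linarith)
      have hu : infDist u A ≤ s := (infDist_le_dist_of_mem ha).trans hua
      have hρu : ∀ y, dist (ρ u) y ≤ r y + t := by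
        intro y
        refine (shadow u hu y).trans (max_le ?_ ?_)
        · linarith [dist_triangle u z y, hzr y]
        · have : infDist y A ≤ r y := le_max_right _ _
          linarith
      -- The ball about `ρ u ∈ A` forces the new point within `t` of `A`.
      obtain ⟨p, hp⟩ := hX.exists_of_set (S := insert (ρ u, t) (range fun y => (y, r y)))
        ⟨_, mem_insert _ _⟩
        (by
          rintro _ (rfl | ⟨y, rfl⟩)
          exacts [hs.le.trans ht, hr0 y])
        (by
          rintro _ (rfl | ⟨y, rfl⟩) _ (rfl | ⟨y', rfl⟩)
          · simp only [dist_self]; linarith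
          · linarith [hρu y']
          · rw [dist_comm]; exact hρu y
          · exact dist_le_max_add_max _ _ _ _ _)
      exact ⟨p, (infDist_le_dist_of_mem (hρA u hu)).trans (hp _ (mem_insert _ _)),
        fun y => hp (y, r y) (mem_insert_of_mem _ ⟨y, rfl⟩)⟩
  obtain ⟨n, hn⟩ := exists_nat_ge (infDist z₀ A / (s / 2))
  rw [div_le_iff₀ (by positivity)] at hn
  obtain ⟨z, hz, hzr⟩ := descend n ⟨z₀, by linarith, fun y => le_max_left _ _⟩
  exact ⟨ρ z, hρA z hz, fun y _ => (shadow z hz y).trans (max_le (hzr y) (le_max_right _ _))⟩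

lemma mem_cthickening_iff_infDist_le (hA : A.Nonempty) {s : ℝ} (hs : 0 ≤ s) {x : X} :
    x ∈ cthickening s A ↔ infDist x A ≤ s :=
  mem_cthickening_iff.trans (infEDist_le_ofReal_iff hA hs)

lemma ExternallyHyperconvexIn.univ_of_cthickening (hX : HyperconvexSpace X) (hA : A.Nonempty)
    {s : ℝ} (hs : 0 < s) (h : ExternallyHyperconvexIn A (cthickening s A)) :
    ExternallyHyperconvexIn A univ := by
  refine (HasShadows.univ_of_infDist_le hX hA hs fun z _ => ?_).externallyHyperconvexIn hX hA
  obtain ⟨a, ha, h'⟩ := h.hasShadows hA z (mem_univ z)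
  exact ⟨a, ha, fun y hy => h' y ((mem_cthickening_iff_infDist_le hA hs.le).2 hy)⟩

/-! ### Convex bicombings -/

/-- A midpoint argument: at the first positive maximum of the distance to `A` along a geodesic, a
common nearest point `a` of two symmetric neighbours and convexity of the distance to `a` give an
earlier maximum. -/
lemma ExternallyHyperconvexIn.bicombingConvex (h : ExternallyHyperconvexIn A univ)
    (hA : A.Nonempty) {σ : X → X → ℝ → X} (hσ : IsConvexGeodesicBicombing σ) :
    BicombingConvex σ A := by
  intro x hx y hy
  set f : ℝ → ℝ := fun t => infDist (σ x y t) A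
  set l := dist x y
  have hl : 0 ≤ l := dist_nonneg
  have hlip : ∀ s ∈ Icc (0 : ℝ) 1, ∀ t ∈ Icc (0 : ℝ) 1, f s ≤ f t + l * |s - t| := by
    intro s hs t ht
    refine (infDist_le_infDist_add_dist (y := σ x y t)).trans_eq ?_
    rw [hσ.geodesic x y s hs t ht, mul_comm]
  have hf0 : f 0 = 0 := by simp only [f, hσ.zero]; exact infDist_zero_of_mem hx
  have hf1 : f 1 = 0 := by simp only [f, hσ.one]; exact infDist_zero_of_mem hy
  have hcont : ContinuousOn f (Icc 0 1) := by
    refine LipschitzOnWith.continuousOn (K := l.toNNReal) ?_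
    refine LipschitzOnWith.of_le_add_mul _ fun s hs t ht => ?_
    rw [Real.coe_toNNReal _ hl, Real.dist_eq]
    exact hlip s hs t ht
  obtain ⟨m, hm, hmax⟩ := isCompact_Icc.exists_isMaxOn
    (nonempty_Icc.2 (zero_le_one (α := ℝ))) hcont
  have hmax' : ∀ t ∈ Icc (0 : ℝ) 1, f t ≤ f m := fun t ht => hmax ht
  have hM : f m = 0 := by
    by_contra hne
    have hpos : 0 < f m := lt_of_le_of_ne infDist_nonneg (Ne.symm hne)
    have hcomp : IsCompact (Icc (0 : ℝ) 1 ∩ f ⁻¹' {f m}) :=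
      isCompact_Icc.of_isClosed_subset (hcont.preimage_isClosed_of_isClosed isClosed_Icc
        isClosed_singleton) inter_subset_left
    obtain ⟨t, ⟨⟨ht0, ht1⟩, htm⟩, hleast⟩ := hcomp.exists_isLeast ⟨m, hm, rfl⟩
    have htm' : f t = f m := htm
    have ht0' : 0 < t := lt_of_le_of_ne ht0 (by rintro rfl; linarith)
    have ht1' : t < 1 := lt_of_le_of_ne ht1 (by rintro rfl; linarith)
    obtain ⟨k, hk0, hkt, hkt', hkl⟩ : ∃ k, 0 < k ∧ k ≤ t ∧ k ≤ 1 - t ∧ l * k ≤ f m / 2 := by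
      refine ⟨min (min t (1 - t)) (f m / 2 / (l + 1)), ?_, ?_, ?_, ?_⟩
      · have : 0 < 1 - t := by linarith
        positivity
      · exact (min_le_left _ _).trans (min_le_left _ _)
      · exact (min_le_left _ _).trans (min_le_right _ _)
      · calc l * min (min t (1 - t)) (f m / 2 / (l + 1)) ≤ (l + 1) * (f m / 2 / (l + 1)) := by
              gcongr
              · linarith
              · exact min_le_right _ _
          _ = f m / 2 := by field_simp
    have hI : t ∈ Icc (0 : ℝ) 1 := ⟨ht0, ht1⟩
    have hI1 : t - k ∈ Icc (0 : ℝ) 1 := ⟨by linarith, by linarith⟩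
    have hI2 : t + k ∈ Icc (0 : ℝ) 1 := ⟨by linarith, by linarith⟩
    have e1 := hlip t hI (t - k) hI1
    have e2 := hlip t hI (t + k) hI2
    rw [show t - (t - k) = k by ring, abs_of_pos hk0] at e1
    rw [show t - (t + k) = -k by ring, abs_neg, abs_of_pos hk0] at e2
    have hd := hσ.geodesic x y (t - k) hI1 (t + k) hI2
    rw [show t - k - (t + k) = -(2 * k) by ring, abs_neg, abs_of_pos (by positivity)] at hd
    -- Both radii are at least `f m - l * k`, and `l * k ≤ f m / 2`.
    have hd' : dist (σ x y (t - k)) (σ x y (t + k)) ≤ f (t - k) + f (t + k) := by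
      rw [hd]
      change 2 * k * l ≤ _
      linarith
    obtain ⟨a, ha, h'⟩ := h.exists_of_set hA
      (S := {(σ x y (t - k), f (t - k)), (σ x y (t + k), f (t + k))}) ⟨_, Or.inl rfl⟩
      (fun _ _ => mem_univ _) (by rintro p (rfl | rfl) <;> exact le_rfl)
      (by
        have n1 : 0 ≤ f (t - k) := infDist_nonneg
        have n2 : 0 ≤ f (t + k) := infDist_nonneg
        rintro p (rfl | rfl) q (rfl | rfl) <;> simp only [dist_self] <;>
          first | linarith | (rw [dist_comm]; linarith))
    have h1 : dist a (σ x y (t - k)) ≤ f (t - k) := h' (_, _) (Or.inl rfl)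
    have h2 : dist a (σ x y (t + k)) ≤ f (t + k) := h' (_, _) (Or.inr rfl)
    have hconst : ∀ u ∈ Icc (0 : ℝ) 1, σ a a u = a := by
      intro u hu
      have := hσ.geodesic a a u hu 0 ⟨le_rfl, zero_le_one⟩
      rw [hσ.zero, dist_self, mul_zero] at this
      exact dist_eq_zero.1 this
    have hc := (hσ.convex x y a a).2 hI1 hI2 one_half_pos.le one_half_pos.le (add_halves 1)
    simp only [smul_eq_mul] at hc
    rw [show 1 / 2 * (t - k) + 1 / 2 * (t + k) = t by ring, hconst _ hI, hconst _ hI1,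
      hconst _ hI2] at hc
    rw [dist_comm a] at h1 h2
    have h3 : f t ≤ dist (σ x y t) a := infDist_le_dist_of_mem ha
    have h4 := hmax' (t + k) hI2
    have h5 : f (t - k) = f m := le_antisymm (hmax' _ hI1) (by linarith)
    have h6 : t ≤ t - k := hleast ⟨hI1, h5⟩
    linarith
  intro t ht
  obtain ⟨a, ha, h'⟩ := h.hasShadows hA (σ x y t) (mem_univ _)
  have h1 : f t = 0 := le_antisymm (hM ▸ hmax' t ht) infDist_nonneg
  have h2 := h' (σ x y t) (mem_univ _)
  rw [dist_self, show infDist (σ x y t) A = 0 from h1, max_self] at h2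
  rwa [← dist_le_zero.1 h2]

/-- A local shadow `a` of `z` already handles far `y`: the geodesic from `z` to `y` stays near `A`,
and its point at distance `s` from `z` is within `s` of `a`, so `d(a,y) ≤ s + (d(z,y) - s)`. -/
lemma BicombingConvex.externallyHyperconvexIn (hX : HyperconvexSpace X) (hA : A.Nonempty)
    {σ : X → X → ℝ → X} (hσ : IsGeodesicBicombing σ) (hconv : BicombingConvex σ A)
    (hloc : UniformlyLocallyExternallyHyperconvex A) : ExternallyHyperconvexIn A univ := by
  obtain ⟨r, hr, hloc⟩ := hloc
  -- Test points within `2s` of `z₀ ∈ A` need a ball of radius more than `4s`.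
  obtain ⟨s, hs, rfl⟩ : ∃ s, 0 < s ∧ r = 5 * s := ⟨r / 5, by positivity, by ring⟩
  refine (HasShadows.univ_of_infDist_le hX hA (half_pos hs) fun z hz => ?_).externallyHyperconvexIn
    hX hA
  have close : ∀ y, infDist y A ≤ s / 2 → ∃ b ∈ A, dist y b < s := fun y hy =>
    (infDist_lt_iff hA).1 (by linarith)
  obtain ⟨z₀, hz₀, hzz₀⟩ := close z hz
  obtain ⟨a, ha, h'⟩ := exists_mem_of_inter_closedBall hA (hloc z₀ hz₀)
    (S := (fun y => (y, max (dist z y) (infDist y A))) '' closedBall z₀ (2 * s))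
    ⟨_, z₀, mem_closedBall_self (by positivity), rfl⟩
    (by
      rintro _ ⟨y, hy, rfl⟩
      have h1 : dist y z₀ ≤ 2 * s := hy
      have h2 : infDist y A ≤ dist y z₀ := infDist_le_dist_of_mem hz₀
      change dist y z₀ + infDist y A < _
      linarith)
    (by rintro _ ⟨y, hy, rfl⟩; exact le_max_right _ _)
    (by rintro _ ⟨y, hy, rfl⟩ _ ⟨y', hy', rfl⟩; exact dist_le_max_add_max _ _ _ _ _)
  have near : ∀ y, dist y z ≤ s → dist a y ≤ max (dist z y) (infDist y A) := fun y hy =>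
    h' (y, _) ⟨y, mem_closedBall.2 (by linarith [dist_triangle y z z₀]), rfl⟩
  refine ⟨a, ha, fun y hy => ?_⟩
  rcases le_total (dist y z) s with hyz | hyz
  · exact near y hyz
  obtain ⟨y₀, hy₀, hyy₀⟩ := close y hy
  refine le_max_of_le_left ?_
  have hD : 0 < dist z y := by rw [dist_comm]; linarith
  have hu : s / dist z y ∈ Icc (0 : ℝ) 1 :=
    ⟨by positivity, (div_le_one hD).2 (by rwa [dist_comm])⟩
  generalize hueq : s / dist z y = u at hu
  have hus : u * dist z y = s := by rw [← hueq]; field_simp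
  have e1 := hσ.geodesic z y u hu 0 ⟨le_rfl, zero_le_one⟩
  have e2 := hσ.geodesic z y u hu 1 ⟨zero_le_one, le_rfl⟩
  rw [hσ.zero, sub_zero, abs_of_nonneg hu.1, hus] at e1
  rw [hσ.one, abs_of_nonpos (by linarith [hu.2])] at e2
  have h1 : infDist (σ z y u) A ≤ s := by
    refine (infDist_le_dist_of_mem (hconv z₀ hz₀ y₀ hy₀ u hu)).trans
      ((hσ.weaklyConvex z y z₀ y₀ u hu).trans ?_)
    have := mul_le_mul_of_nonneg_left hzz₀.le (sub_nonneg.2 hu.2)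
    have := mul_le_mul_of_nonneg_left hyy₀.le hu.1
    linarith
  have h2 : dist a (σ z y u) ≤ s :=
    (near _ e1.le).trans (max_le (by rw [dist_comm]; exact e1.le) h1)
  have := dist_triangle a (σ z y u) y
  linarith

theorem mainTheorem6 {X : Type u} [MetricSpace X] (hX : HyperconvexSpace X)
    (A : Set X) (hA : A.Nonempty) :
    List.TFAE [
      ExternallyHyperconvexIn A Set.univ,
      ∀ x : X, ∀ r : ℝ, Metric.infDist x A ≤ r →
        ExternallyHyperconvexIn (A ∩ Metric.closedBall x r) (Metric.closedBall x r),
      ∃ x : X, ∀ r : ℝ, Metric.infDist x A ≤ r →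
        ExternallyHyperconvexIn (A ∩ Metric.closedBall x r) (Metric.closedBall x r),
      ∀ s : ℝ, 0 < s → ExternallyHyperconvexIn A (Metric.cthickening s A),
      ∃ s : ℝ, 0 < s ∧ ExternallyHyperconvexIn A (Metric.cthickening s A),
      ∃ ρ : X → X, IsProximinalLipschitzRetraction A ρ ∧
        ∀ x y : X, dist (ρ x) y ≤ max (dist x y) (Metric.infDist y A)] ∧
    ∀ σ : X → X → ℝ → X, IsConvexGeodesicBicombing σ →
      (ExternallyHyperconvexIn A Set.univ ↔
        BicombingConvex σ A ∧ UniformlyLocallyExternallyHyperconvex A) := by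
  constructor
  · tfae_have 1 → 2 := fun h x r hr => h.inter_closedBall hA hr
    tfae_have 2 → 3 := fun h => ⟨hA.some, h _⟩
    tfae_have 3 → 1 := fun ⟨_, h⟩ => externallyHyperconvexIn_univ_of_inter_closedBall hX hA h
    tfae_have 1 → 4 := fun h s _ => h.mono (self_subset_cthickening A)
    tfae_have 4 → 5 := fun h => ⟨1, one_pos, h 1 one_pos⟩
    tfae_have 5 → 1 := fun ⟨_, hs, h⟩ => ExternallyHyperconvexIn.univ_of_cthickening hX hA hs h
    tfae_have 1 → 6 := fun h => h.exists_retraction hA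
    tfae_have 6 → 1 := fun ⟨ρ, hρ, h⟩ => HasShadows.externallyHyperconvexIn hX hA
      fun z _ => ⟨ρ z, hρ.mapsTo z, fun y _ => h z y⟩
    tfae_finish
  · intro σ hσ
    refine ⟨fun h => ⟨h.bicombingConvex hA hσ, 1, one_pos, fun x hx => ?_⟩, fun h =>
      h.1.externallyHyperconvexIn hX hA hσ.toIsGeodesicBicombing h.2⟩
    exact h.inter_closedBall hA (by rw [infDist_zero_of_mem hx]; exact zero_le_one)
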